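/- **Terms.** Let $\mathcal F$ be a finite signature, partitioned into defined symbols $\mathcal D$ and constructors $\mathcal C$, and let $\mathcal V$ be a countably infinite set of variables. *Values* are the terms built from variables and constructors; *basic terms* are the variables and the terms $f(v_1,\dots,v_n)$ with $f\in\mathcal D$ and all $v_i$ values. The depth is $\mathrm{dp}(x)=1$ for variables $x$ and $\mathrm{dp}(f(t_1,\dots,t_n))=1+\max_i \mathrm{dp}(t_i)$, where $\max\varnothing=0$; the size $|t|$ is the number of occurrences of variables and function symbols in $t$. **Rewriting.** A *TRS* $\mathcal R$ is a finite set of rules $l\to r$ such that $l$ is not a variable and all variables of $r$ occur in $l$; it is a *constructor TRS* if all left-hand sides are basic. The innermost rewrite relation $\xrightarrow{\mathsf i}_{\mathcal R}$ contracts (in arbitrary context) instances $l\sigma$ of left-hand sides to $r\sigma$, provided that all arguments of $l\sigma$ are normal forms of $\mathcal R$. The innermost derivation height $\mathrm{dh}(s)$ is the maximal length $\ell$ of an innermost reduction $s=t_0\xrightarrow{\mathsf i}_{\mathcal R}t_1\xrightarrow{\mathsf i}_{\mathcal R}\cdots\xrightarrow{\mathsf i}_{\mathcal R}t_\ell$ (it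 is $\infty$ if these lengths are unbounded), and the innermost runtime complexity is $\mathrm{rc}_{\mathcal R}(n)=\sup\{\mathrm{dh}(s)\mid s \text{ basic},\ |s|\le n\}$. **Precedences and safe mappings.** A *precedence* is a preorder $\succsim$ on $\mathcal F$, with strict part $\succ$ and equivalence $\sim$. It is *admissible* if $f\sim g$ implies that $f,g$ are both defined or both constructors. A *safe mapping* selects for every symbol a set of *safe* argument positions; the remaining positions are *normal*. All positions of constructors are safe. Fix a precedence and a safe mapping. *Safe equivalence* $s\approx t$ is defined inductively: $s=t$, or $s=f(s_1,\dots,s_n)$, $t=g(t_1,\dots,t_n)$, $f\sim g$ and for some permutation $\pi$, for all $i$, $s_i\approx t_{\pi(i)}$ and ($i$ is safe for $f$ iff $\pi(i)$ is safe for $g$). For a relation $>$ on terms and finite multisets $M,N$ of terms, $M>_{\mathrm{mul}}N$ means that $M=Z\uplus X$ and $N=Z'\uplus Y$, where $X\neq\varnothing$, the elements of $Z$ and $Z'$ are matched bijectively by $\approx$, and each $y\in Y$ has some $x\in X$ with $x>y$; and $M\geq_{\mathrm{mul}}N$ means that $M>_{\mathrm{mul}}N$ or the elements of $M$ and $N$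 are matched bijectively by $\approx$. **The orders.** The auxiliary order $\sqsupset$ is the least relation such that, for $s=f(s_1,\dots,s_n)$, $s\sqsupset t$ holds if 1. $s_i\sqsupset t$ or $s_i\approx t$ for some $i$, where $i$ is a normal position of $f$ in case $f\in\mathcal D$; or 2. $f\in\mathcal D$, $t=g(t_1,\dots,t_m)$, $f\succ g$, and $s\sqsupset t_j$ for all $j$. The polynomial path order $>_{\mathrm{pop}*}$ is the least relation such that, for $s=f(s_1,\dots,s_n)$, $s>_{\mathrm{pop}*}t$ holds if 1. $s_i>_{\mathrm{pop}*}t$ or $s_i\approx t$ for some $i$; or 2. $f\in\mathcal D$, $t=g(t_1,\dots,t_m)$, $f\succ g$, $s\sqsupset t_j$ for all normal positions $j$ of $g$, $s>_{\mathrm{pop}*}t_j$ for all safe positions $j$ of $g$, and for at most one safe position $j$ of $g$ the term $t_j$ contains a function symbol $h$ with $f\not\succ h$; or 3. $f\in\mathcal D$, $t=g(t_1,\dots,t_m)$, $f\sim g$, and with respect to $>_{\mathrm{pop}*}$ the multiset of normal arguments of $s$ is $>_{\mathrm{mul}}$ that of $t$, and the multiset of safe arguments of $s$ is $\geq_{\mathrm{mul}}$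 that of $t$. A constructor TRS $\mathcal R$ is *predicative recursive* if there are an admissible precedence and a safe mapping such that $l>_{\mathrm{pop}*}r$ for every rule $l\to r$ of $\mathcal R$. **Theorem.** Let $\mathcal R$ be a predicative recursive TRS. Then there is a polynomial $p$ with coefficients in $\mathbb N$, depending only on $\mathcal R$ and the signature, such that for every admissible precedence and safe mapping for which $l>_{\mathrm{pop}*}r$ holds for all rules of $\mathcal R$, and for every basic term $f(u_1,\dots,u_n)$ with $f\in\mathcal D$, $$\mathrm{dh}(f(u_1,\dots,u_n))\le p\bigl(\max\{\mathrm{dp}(u_i)\mid i\text{ a normal position of }f\}\bigr)$$ (where $\max\varnothing=0$). In particular, the innermost runtime complexity of $\mathcal R$ is polynomial: there is a polynomial $q$ with coefficients in $\mathbb N$ such that $\mathrm{rc}_{\mathcal R}(n)\le q(n)$ for all $n\in\mathbb N$. -/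

import Mathlib

open FirstOrder Language

/-! Innermost rewriting and the polynomial path order, over first-order terms `L.Term ℕ`
(the relation symbols of `L` play no role; variables are natural numbers). -/

namespace PopStar

universe u v

variable {L : FirstOrder.Language.{u, v}}

/-- The function symbols of the signature; the arity of `f` is `f.1`. -/
abbrev Sym (L : FirstOrder.Language.{u, v}) : Type u := Σ n : ℕ, L.Functions n

/-- The number of occurrences of variables and function symbols. -/
def size : L.Term ℕ → ℕ
  | .var _ => 1
  | .func _ ts => 1 + ∑ i, size (ts i)

/-- The depth; the maximum of the empty set is `0`, so variables and constants have depth `1`. -/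
def depth : L.Term ℕ → ℕ
  | .var _ => 1
  | .func _ ts => 1 + Finset.univ.sup fun i => depth (ts i)

/-- `OverSym P t`: every function symbol in `t` satisfies `P`, i.e. `t ∈ T({f | P f}, V)`. -/
def OverSym (P : Sym L → Prop) : L.Term ℕ → Prop
  | .var _ => True
  | .func f ts => P ⟨_, f⟩ ∧ ∀ i, OverSym P (ts i)

/-- Values: terms built from variables and constructors. `D` is the set of defined symbols,
its complement is the set of constructors. -/
def IsValue (D : Set (Sym L)) : L.Term ℕ → Prop := OverSym fun f => f ∉ D

/-- Basic terms: variables, and terms `f(v₁, …, vₙ)` with `f` defined and all `vᵢ` values. -/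
def IsBasic (D : Set (Sym L)) : L.Term ℕ → Prop
  | .var _ => True
  | .func f ts => (⟨_, f⟩ : Sym L) ∈ D ∧ ∀ i, IsValue D (ts i)

/-! ### Rewriting -/

/-- A finite term rewrite system: a finite set of pairs `(l, r)` such that `l` is not a variable
and every variable of `r` occurs in `l`. -/
structure TRS (L : FirstOrder.Language.{u, v}) where
  rules : Set (L.Term ℕ × L.Term ℕ)
  finite : rules.Finite
  lhs_ne_var : ∀ ρ ∈ rules, ∀ x : ℕ, ρ.1 ≠ Term.var x
  vars_subset : ∀ ρ ∈ rules, ρ.2.varFinset ⊆ ρ.1.varFinset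

/-- All left-hand sides are basic. -/
def IsConstructorTRS (D : Set (Sym L)) (R : TRS L) : Prop :=
  ∀ ρ ∈ R.rules, IsBasic D ρ.1

/-- The rewrite relation. -/
inductive Rew (R : TRS L) : L.Term ℕ → L.Term ℕ → Prop
  | root (l r : L.Term ℕ) (σ : ℕ → L.Term ℕ) (h : (l, r) ∈ R.rules) :
      Rew R (l.subst σ) (r.subst σ)
  | ctx {n : ℕ} (f : L.Functions n) (ts : Fin n → L.Term ℕ) (i : Fin n) (t' : L.Term ℕ)
      (h : Rew R (ts i) t') :
      Rew R (Term.func f ts) (Term.func f (Function.update ts i t'))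

def IsNF (R : TRS L) (s : L.Term ℕ) : Prop := ∀ t, ¬ Rew R s t

/-- The innermost rewrite relation: all arguments of the contracted redex are normal forms. -/
inductive IRew (R : TRS L) : L.Term ℕ → L.Term ℕ → Prop
  | root {n : ℕ} (f : L.Functions n) (ls : Fin n → L.Term ℕ) (r : L.Term ℕ)
      (σ : ℕ → L.Term ℕ) (h : (Term.func f ls, r) ∈ R.rules)
      (hnf : ∀ i, IsNF R ((ls i).subst σ)) :
      IRew R ((Term.func f ls).subst σ) (r.subst σ)
  | ctx {n : ℕ} (f : L.Functions n) (ts : Fin n → L.Term ℕ) (i : Fin n) (t' : L.Term ℕ)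
      (h : IRew R (ts i) t') :
      IRew R (Term.func f ts) (Term.func f (Function.update ts i t'))

/-- There is an innermost reduction `s = t₀ → t₁ → ⋯ → t_ℓ`. -/
def HasReduction (R : TRS L) (s : L.Term ℕ) (ℓ : ℕ) : Prop :=
  ∃ t : ℕ → L.Term ℕ, t 0 = s ∧ ∀ i < ℓ, IRew R (t i) (t (i + 1))

/-- The innermost derivation height; it is `⊤` if the lengths of the innermost reductions that
start in `s` are unbounded. -/
noncomputable def dheight (R : TRS L) (s : L.Term ℕ) : ℕ∞ :=
  ⨆ (ℓ : ℕ) (_ : HasReduction R s ℓ), (ℓ : ℕ∞)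

/-- The innermost runtime complexity function. -/
noncomputable def rc (D : Set (Sym L)) (R : TRS L) (n : ℕ) : ℕ∞ :=
  ⨆ (s : L.Term ℕ) (_ : IsBasic D s) (_ : size s ≤ n), dheight R s

/-! ### Precedences and safe mappings -/

/-- A (quasi-)precedence is a preorder on the function symbols. -/
structure Precedence (L : FirstOrder.Language.{u, v}) where
  ge : Sym L → Sym L → Prop
  refl : ∀ f, ge f f
  trans : ∀ f g h, ge f g → ge g h → ge f h

/-- The induced proper order. -/
def Precedence.gt (P : Precedence L) (f g : Sym L) : Prop := P.ge f g ∧ ¬ P.ge g f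

/-- The induced equivalence. -/
def Precedence.equiv (P : Precedence L) (f g : Sym L) : Prop := P.ge f g ∧ P.ge g f

/-- Equivalent symbols are both defined or both constructors. -/
def Precedence.Admissible (P : Precedence L) (D : Set (Sym L)) : Prop :=
  ∀ f g, P.equiv f g → (f ∈ D ↔ g ∈ D)

/-- A safe mapping selects the safe argument positions of every symbol, the others being normal.
All argument positions of constructors are safe. -/
structure SafeMapping (D : Set (Sym L)) where
  safe : ∀ f : Sym L, Set (Fin f.1)
  constructor_safe : ∀ f, f ∉ D → safe f = Set.univ

variable {D : Set (Sym L)}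

/-- The position `i` of `f` is safe. -/
def SafeMapping.IsSafe (S : SafeMapping D) {n : ℕ} (f : L.Functions n) (i : Fin n) : Prop :=
  i ∈ S.safe ⟨n, f⟩

open Classical in
/-- The multiset of the normal arguments of `f(t₁, …, tₙ)`. -/
noncomputable def SafeMapping.normalArgs (S : SafeMapping D) {n : ℕ} (f : L.Functions n)
    (ts : Fin n → L.Term ℕ) : Multiset (L.Term ℕ) :=
  (Finset.univ.filter fun i => ¬ S.IsSafe f i).val.map ts

open Classical in
/-- The multiset of the safe arguments of `f(t₁, …, tₙ)`. -/
noncomputable def SafeMapping.safeArgs (S : SafeMapping D) {n : ℕ} (f : L.Functions n)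
    (ts : Fin n → L.Term ℕ) : Multiset (L.Term ℕ) :=
  (Finset.univ.filter fun i => S.IsSafe f i).val.map ts

open Classical in
/-- The maximal depth of the normal arguments of `f(t₁, …, tₙ)`; it is `0` if there are none. -/
noncomputable def SafeMapping.normalDepth (S : SafeMapping D) {n : ℕ} (f : L.Functions n)
    (ts : Fin n → L.Term ℕ) : ℕ :=
  (Finset.univ.filter fun i => ¬ S.IsSafe f i).sup fun i => depth (ts i)

/-! ### Multiset extensions -/

/-- The strict multiset extension of `gt` modulo the equivalence `eqv`: up to `eqv`, the multiset
`N` arises from `M` by replacing a nonempty part `X` by a multiset `Y` each of whose elements is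
below some element of `X`. -/
def MulGt {α : Type*} (eqv gt : α → α → Prop) (M N : Multiset α) : Prop :=
  ∃ Z Z' X Y : Multiset α, M = Z + X ∧ N = Z' + Y ∧ Multiset.Rel eqv Z Z' ∧ X ≠ 0 ∧
    ∀ y ∈ Y, ∃ x ∈ X, gt x y

/-- The weak multiset extension. -/
def MulGe {α : Type*} (eqv gt : α → α → Prop) (M N : Multiset α) : Prop :=
  MulGt eqv gt M N ∨ Multiset.Rel eqv M N

theorem MulGt.mono {α : Type*} {eqv gt gt' : α → α → Prop} (h : ∀ a b, gt a b → gt' a b)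
    {M N : Multiset α} : MulGt eqv gt M N → MulGt eqv gt' M N := by
  rintro ⟨Z, Z', X, Y, hM, hN, hZ, hX, hY⟩
  refine ⟨Z, Z', X, Y, hM, hN, hZ, hX, fun y hy => ?_⟩
  obtain ⟨x, hx, hxy⟩ := hY y hy
  exact ⟨x, hx, h _ _ hxy⟩

theorem MulGe.mono {α : Type*} {eqv gt gt' : α → α → Prop} (h : ∀ a b, gt a b → gt' a b)
    {M N : Multiset α} : MulGe eqv gt M N → MulGe eqv gt' M N :=
  Or.imp (MulGt.mono h) id

/-! ### The polynomial path order -/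

/-- Safe equivalence: equality up to equivalence of symbols and permutations of arguments that
respect the separation of safe and normal positions. -/
inductive SafeEquiv (P : Precedence L) (S : SafeMapping D) : L.Term ℕ → L.Term ℕ → Prop
  | refl (t : L.Term ℕ) : SafeEquiv P S t t
  | perm {n : ℕ} (f g : L.Functions n) (ss ts : Fin n → L.Term ℕ) (π : Equiv.Perm (Fin n))
      (hfg : P.equiv ⟨n, f⟩ ⟨n, g⟩) (hargs : ∀ i, SafeEquiv P S (ss i) (ts (π i)))
      (hsafe : ∀ i, S.IsSafe f i ↔ S.IsSafe g (π i)) :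
      SafeEquiv P S (Term.func f ss) (Term.func g ts)

/-- The auxiliary order. The first two constructors together say that some argument (a normal
one if `f` is defined) is above `t` or equivalent to `t`. -/
inductive AuxGt (P : Precedence L) (S : SafeMapping D) : L.Term ℕ → L.Term ℕ → Prop
  | st_gt {n : ℕ} (f : L.Functions n) (ss : Fin n → L.Term ℕ) (t : L.Term ℕ) (i : Fin n)
      (hi : (⟨n, f⟩ : Sym L) ∈ D → ¬ S.IsSafe f i) (h : AuxGt P S (ss i) t) :
      AuxGt P S (Term.func f ss) t
  | st_eq {n : ℕ} (f : L.Functions n) (ss : Fin n → L.Term ℕ) (t : L.Term ℕ) (i : Fin n)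
      (hi : (⟨n, f⟩ : Sym L) ∈ D → ¬ S.IsSafe f i) (h : SafeEquiv P S (ss i) t) :
      AuxGt P S (Term.func f ss) t
  | ia {n m : ℕ} (f : L.Functions n) (ss : Fin n → L.Term ℕ)
      (g : L.Functions m) (ts : Fin m → L.Term ℕ)
      (hf : (⟨n, f⟩ : Sym L) ∈ D) (hfg : P.gt ⟨n, f⟩ ⟨m, g⟩)
      (h : ∀ j, AuxGt P S (Term.func f ss) (ts j)) :
      AuxGt P S (Term.func f ss) (Term.func g ts)

/-- The polynomial path order. In the last clause the relation `Q` is an arbitrary part of the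
order being defined; as multiset extensions are monotone, this is the multiset comparison with
respect to the order itself. `popGt_iff` below displays the clauses in that form. The hypothesis
`hone` says that at most one safe argument of the right-hand side contains a function symbol that
is not below `f` in the precedence. -/
inductive PopGt (P : Precedence L) (S : SafeMapping D) : L.Term ℕ → L.Term ℕ → Prop
  | st_gt {n : ℕ} (f : L.Functions n) (ss : Fin n → L.Term ℕ) (t : L.Term ℕ) (i : Fin n)
      (h : PopGt P S (ss i) t) :
      PopGt P S (Term.func f ss) t
  | st_eq {n : ℕ} (f : L.Functions n) (ss : Fin n → L.Term ℕ) (t : L.Term ℕ) (i : Fin n)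
      (h : SafeEquiv P S (ss i) t) :
      PopGt P S (Term.func f ss) t
  | ia {n m : ℕ} (f : L.Functions n) (ss : Fin n → L.Term ℕ)
      (g : L.Functions m) (ts : Fin m → L.Term ℕ)
      (hf : (⟨n, f⟩ : Sym L) ∈ D) (hfg : P.gt ⟨n, f⟩ ⟨m, g⟩)
      (hnormal : ∀ j, ¬ S.IsSafe g j → AuxGt P S (Term.func f ss) (ts j))
      (hsafe : ∀ j, S.IsSafe g j → PopGt P S (Term.func f ss) (ts j))
      (hone : {j | S.IsSafe g j ∧ ¬ OverSym (fun h => P.gt ⟨n, f⟩ h) (ts j)}.Subsingleton) :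
      PopGt P S (Term.func f ss) (Term.func g ts)
  | ep {n m : ℕ} (f : L.Functions n) (ss : Fin n → L.Term ℕ)
      (g : L.Functions m) (ts : Fin m → L.Term ℕ)
      (hf : (⟨n, f⟩ : Sym L) ∈ D) (hfg : P.equiv ⟨n, f⟩ ⟨m, g⟩)
      (Q : L.Term ℕ → L.Term ℕ → Prop) (hQ : ∀ a b, Q a b → PopGt P S a b)
      (hnormal : MulGt (SafeEquiv P S) Q (S.normalArgs f ss) (S.normalArgs g ts))
      (hsafe : MulGe (SafeEquiv P S) Q (S.safeArgs f ss) (S.safeArgs g ts)) :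
      PopGt P S (Term.func f ss) (Term.func g ts)

/-- The defining clauses of the polynomial path order for a left-hand side `f(s₁, …, sₙ)`. -/
theorem popGt_iff (P : Precedence L) (S : SafeMapping D) {n : ℕ} (f : L.Functions n)
    (ss : Fin n → L.Term ℕ) (t : L.Term ℕ) :
    PopGt P S (Term.func f ss) t ↔
      (∃ i, PopGt P S (ss i) t ∨ SafeEquiv P S (ss i) t) ∨
      (∃ (m : ℕ) (g : L.Functions m) (ts : Fin m → L.Term ℕ), t = Term.func g ts ∧
        (⟨n, f⟩ : Sym L) ∈ D ∧ P.gt ⟨n, f⟩ ⟨m, g⟩ ∧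
        (∀ j, ¬ S.IsSafe g j → AuxGt P S (Term.func f ss) (ts j)) ∧
        (∀ j, S.IsSafe g j → PopGt P S (Term.func f ss) (ts j)) ∧
        {j | S.IsSafe g j ∧ ¬ OverSym (fun h => P.gt ⟨n, f⟩ h) (ts j)}.Subsingleton) ∨
      (∃ (m : ℕ) (g : L.Functions m) (ts : Fin m → L.Term ℕ), t = Term.func g ts ∧
        (⟨n, f⟩ : Sym L) ∈ D ∧ P.equiv ⟨n, f⟩ ⟨m, g⟩ ∧
        MulGt (SafeEquiv P S) (PopGt P S) (S.normalArgs f ss) (S.normalArgs g ts) ∧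
        MulGe (SafeEquiv P S) (PopGt P S) (S.safeArgs f ss) (S.safeArgs g ts)) := by
  constructor
  · intro h
    cases h with
    | st_gt _ _ _ i h => exact Or.inl ⟨i, Or.inl h⟩
    | st_eq _ _ _ i h => exact Or.inl ⟨i, Or.inr h⟩
    | ia _ _ g ts hf hfg h1 h2 h3 => exact Or.inr (Or.inl ⟨_, g, ts, rfl, hf, hfg, h1, h2, h3⟩)
    | ep _ _ g ts hf hfg Q hQ h1 h2 =>
      exact Or.inr (Or.inr ⟨_, g, ts, rfl, hf, hfg, h1.mono hQ, h2.mono hQ⟩)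
  · rintro (⟨i, h | h⟩ | ⟨m, g, ts, rfl, hf, hfg, h1, h2, h3⟩ | ⟨m, g, ts, rfl, hf, hfg, h1, h2⟩)
    · exact .st_gt f ss t i h
    · exact .st_eq f ss t i h
    · exact .ia f ss g ts hf hfg h1 h2 h3
    · exact .ep f ss g ts hf hfg (PopGt P S) (fun _ _ h => h) h1 h2

/-- Every rule is oriented by the polynomial path order. -/
def Compatible (R : TRS L) (P : Precedence L) (S : SafeMapping D) : Prop :=
  ∀ ρ ∈ R.rules, PopGt P S ρ.1 ρ.2

/-- Predicative recursive TRSs: constructor TRSs that are compatible with a polynomial path order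
with an underlying admissible precedence. -/
def IsPredicativeRecursive (D : Set (Sym L)) (R : TRS L) : Prop :=
  IsConstructorTRS D R ∧
    ∃ (P : Precedence L) (S : SafeMapping D), P.Admissible D ∧ Compatible R P S

end PopStar

/-!
Fix an admissible precedence and a safe mapping that orient the rules. The proof bounds, for a
function symbol `f` applied to normal forms whose normal arguments have depth at most `d` and whose
safe arguments have depth at most `e`, both the length of all innermost reductions by `A d` and the
depth of all reducts by `A d + e`, where `A` is a polynomial (`SymBounded`). That the length does
not depend on `e`, and the depth only additively, is what makes the bounds compose.

The polynomials are found by induction on the level of `f` in the precedence. Since left-hand sides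
are basic, `>pop*` below their arguments is the subterm relation up to safe equivalence, which
decreases the depth of instances (`PopGt.of_isValue`). Consider a root step from `f(v₁, …, vₙ)` to
an instance of the right-hand side `r`.

* Normal arguments of symbols in `r` are handled by the auxiliary order: they contain only symbols
  below `f` and normal arguments of the redex, so by induction their values have depth polynomial
  in `d` (`AuxGt.bounded`).
* On the safe side, at most one argument of each symbol leads to a symbol not below `f`. So there is
  at most one recursive call, its safe arguments are no deeper than those of the redex, and
  its cost is added once (`PopGt.bounded`).
* In a recursive call the multiset of depths of the normal arguments decreases in the
  Dershowitz–Manna order. It has at most `K` elements, `K` being the maximal arity, and they are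
  at most `d`. There are at most `(d + 2) ^ K` such multisets, so counting those below a given one
  gives a rank that decreases with each call and is polynomial in `d` (`multisetRank`).

So the recursion contributes at most `(d + 2) ^ K + 1` times a polynomial
(`bounded_of_rank_le`, `exists_symBounded`). There are only finitely many precedences and safe
mappings, and the sum of the polynomials found for them is a uniform bound.
-/

namespace PopStar

variable {L : FirstOrder.Language} {D : Set (Sym L)} {R : TRS L} {P : Precedence L}
  {S : SafeMapping D}

/-! ### Ranks of multisets of numbers -/

/-- The multisets of at most `k` numbers, all of them at most `d`. -/
def boundedMultisets (d : ℕ) : ℕ → Finset (Multiset ℕ)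
  | 0 => {0}
  | k + 1 => boundedMultisets d k ∪
      Finset.image₂ (fun a M => a ::ₘ M) (Finset.range (d + 1)) (boundedMultisets d k)

theorem card_boundedMultisets_le (d k : ℕ) : (boundedMultisets d k).card ≤ (d + 2) ^ k := by
  induction k with
  | zero => simp [boundedMultisets]
  | succ k ih =>
    calc _ ≤ (boundedMultisets d k).card + (d + 1) * (boundedMultisets d k).card := by
          refine (Finset.card_union_le _ _).trans (Nat.add_le_add_left ?_ _)
          simpa using Finset.card_image₂_le (fun a (M : Multiset ℕ) => a ::ₘ M)
            (Finset.range (d + 1)) (boundedMultisets d k)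
      _ = (boundedMultisets d k).card * (d + 2) := by ring
      _ ≤ (d + 2) ^ (k + 1) := Nat.mul_le_mul_right _ ih

theorem mem_boundedMultisets {d k : ℕ} {M : Multiset ℕ} (hk : M.card ≤ k)
    (hd : ∀ a ∈ M, a ≤ d) : M ∈ boundedMultisets d k := by
  induction k generalizing M with
  | zero => simpa [boundedMultisets] using hk
  | succ k ih =>
    induction M using Multiset.induction_on with
    | empty => exact Finset.mem_union_left _ (ih (by simp) (by simp))
    | cons a M _ =>
      refine Finset.mem_union_right _ (Finset.mem_image₂.2 ⟨a, ?_, M, ih ?_ ?_, rfl⟩)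
      · exact Finset.mem_range.2 (Nat.lt_succ_of_le (hd a (by simp)))
      · simpa using hk
      · exact fun b hb => hd b (Multiset.mem_cons_of_mem hb)

/-- The number of multisets of at most `k` numbers `≤ d` that are below `M` in the
Dershowitz–Manna order. -/
noncomputable def multisetRank (d k : ℕ) (M : Multiset ℕ) : ℕ :=
  Set.ncard {N : Multiset ℕ | N ∈ boundedMultisets d k ∧ N.IsDershowitzMannaLT M}

theorem multisetRank_le (d k : ℕ) (M : Multiset ℕ) : multisetRank d k M ≤ (d + 2) ^ k := by
  refine le_trans ?_ (card_boundedMultisets_le d k)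
  rw [← Set.ncard_coe_finset]
  exact Set.ncard_le_ncard (fun _ hN => hN.1) (Finset.finite_toSet _)

theorem multisetRank_lt {d k : ℕ} {M N : Multiset ℕ} (hk : N.card ≤ k) (hd : ∀ a ∈ N, a ≤ d)
    (h : N.IsDershowitzMannaLT M) : multisetRank d k N < multisetRank d k M := by
  refine Set.ncard_lt_ncard ?_ ((Finset.finite_toSet (boundedMultisets d k)).subset
    fun _ hN => hN.1)
  refine Set.ssubset_iff_exists.2 ⟨fun N' hN' => ⟨hN'.1, hN'.2.trans h⟩, N,
    ⟨mem_boundedMultisets hk hd, h⟩, fun hN => ?_⟩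
  exact Multiset.wellFounded_isDershowitzMannaLT.irrefl.irrefl N hN.2

/-- A multiset comparison whose parts are respected by `φ` becomes a Dershowitz–Manna
comparison of the multisets of values of `φ`. -/
theorem MulGt.isDershowitzMannaLT {α : Type*} {eqv gt : α → α → Prop} {M N : Multiset α}
    (φ : α → ℕ) (heqv : ∀ a b, eqv a b → φ a = φ b) (hgt : ∀ a ∈ M, ∀ b, gt a b → φ b < φ a)
    (h : MulGt eqv gt M N) : (N.map φ).IsDershowitzMannaLT (M.map φ) := by
  obtain ⟨Z, Z', X, Y, rfl, rfl, hZ, hX, hY⟩ := h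
  have hφ : Z.map φ = Z'.map φ :=
    Multiset.rel_eq.1 (Multiset.rel_map.2 (hZ.mono fun a _ b _ hab => heqv a b hab))
  refine ⟨Z.map φ, Y.map φ, X.map φ, ?_, by rw [Multiset.map_add, hφ], by simp, ?_⟩
  · simpa using hX
  · intro y hy
    obtain ⟨b, hb, rfl⟩ := Multiset.mem_map.1 hy
    obtain ⟨a, ha, hab⟩ := hY b hb
    exact ⟨φ a, Multiset.mem_map_of_mem φ ha, hgt a (Multiset.mem_add.2 (.inr ha)) b hab⟩

theorem exists_mem_of_rel {α : Type*} {r : α → α → Prop} {M N : Multiset α}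
    (h : Multiset.Rel r M N) {b : α} (hb : b ∈ N) : ∃ a ∈ M, r a b :=
  Multiset.exists_mem_of_rel_of_mem (Multiset.rel_flip.2 h) hb

theorem MulGt.exists_mem {α : Type*} {eqv gt : α → α → Prop} {M N : Multiset α}
    (h : MulGt eqv gt M N) {b : α} (hb : b ∈ N) : ∃ a ∈ M, gt a b ∨ eqv a b := by
  obtain ⟨Z, Z', X, Y, rfl, rfl, hZ, -, hY⟩ := h
  rcases Multiset.mem_add.1 hb with hb | hb
  · obtain ⟨a, ha, hab⟩ := exists_mem_of_rel hZ hb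
    exact ⟨a, Multiset.mem_add.2 (.inl ha), .inr hab⟩
  · obtain ⟨a, ha, hab⟩ := hY b hb
    exact ⟨a, Multiset.mem_add.2 (.inr ha), .inl hab⟩

theorem MulGe.exists_mem {α : Type*} {eqv gt : α → α → Prop} {M N : Multiset α}
    (h : MulGe eqv gt M N) {b : α} (hb : b ∈ N) : ∃ a ∈ M, gt a b ∨ eqv a b := by
  rcases h with h | h
  · exact h.exists_mem hb
  · obtain ⟨a, ha, hab⟩ := exists_mem_of_rel h hb
    exact ⟨a, ha, .inr hab⟩

/-! ### Innermost steps and normal forms -/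

theorem IRew.rew {s t : L.Term ℕ} (h : IRew R s t) : Rew R s t := by
  induction h with
  | root f ls r σ h _ => exact .root _ _ σ h
  | ctx f ts i t' _ ih => exact .ctx f ts i t' ih

theorem Rew.inv {s t : L.Term ℕ} (h : Rew R s t) :
    (∃ l r σ, (l, r) ∈ R.rules ∧ s = l.subst σ) ∨
      ∃ (n : ℕ) (f : L.Functions n) (ts : Fin n → L.Term ℕ) (i : Fin n) (t' : L.Term ℕ),
        s = .func f ts ∧ Rew R (ts i) t' := by
  cases h with
  | root l r σ h => exact .inl ⟨l, r, σ, h, rfl⟩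
  | ctx f ts i t' h => exact .inr ⟨_, f, ts, i, t', rfl, h⟩

theorem IRew.inv {s t : L.Term ℕ} (h : IRew R s t) :
    (∃ (n : ℕ) (f : L.Functions n) (ls : Fin n → L.Term ℕ) (r : L.Term ℕ) (σ : ℕ → L.Term ℕ),
        (Term.func f ls, r) ∈ R.rules ∧ (∀ i, IsNF R ((ls i).subst σ)) ∧
        s = .func f (fun i => (ls i).subst σ) ∧ t = r.subst σ) ∨
      ∃ (n : ℕ) (f : L.Functions n) (ts : Fin n → L.Term ℕ) (i : Fin n) (t' : L.Term ℕ),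
        s = .func f ts ∧ IRew R (ts i) t' ∧ t = .func f (Function.update ts i t') := by
  cases h with
  | root f ls r σ h hnf => exact .inl ⟨_, f, ls, r, σ, h, hnf, rfl, rfl⟩
  | ctx f ts i t' h => exact .inr ⟨_, f, ts, i, t', rfl, h, rfl⟩

theorem IRew.inv_func {n : ℕ} {f : L.Functions n} {ts : Fin n → L.Term ℕ} {t : L.Term ℕ}
    (h : IRew R (.func f ts) t) :
    (∃ (ls : Fin n → L.Term ℕ) (r : L.Term ℕ) (σ : ℕ → L.Term ℕ),
        (Term.func f ls, r) ∈ R.rules ∧ (∀ i, IsNF R (ts i)) ∧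
        ts = (fun i => (ls i).subst σ) ∧ t = r.subst σ) ∨
      ∃ (i : Fin n) (t' : L.Term ℕ),
        IRew R (ts i) t' ∧ t = .func f (Function.update ts i t') := by
  rcases h.inv with ⟨m, g, ls, r, σ, hr, hnf, hs, rfl⟩ | ⟨m, g, ts', i, t', hs, h', rfl⟩
  · cases hs
    exact .inl ⟨ls, r, σ, hr, hnf, rfl, rfl⟩
  · cases hs
    exact .inr ⟨i, t', h', rfl⟩

theorem isNF_var (x : ℕ) : IsNF R (.var x) := by
  intro t h
  rcases h.inv with ⟨l, r, σ, hr, hs⟩ | ⟨_, _, _, _, _, hs, _⟩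
  · cases l with
    | var y => exact R.lhs_ne_var _ hr y rfl
    | func f ls => cases hs
  · cases hs

theorem IsNF.arg {n : ℕ} {f : L.Functions n} {ts : Fin n → L.Term ℕ}
    (h : IsNF R (.func f ts)) (i : Fin n) : IsNF R (ts i) :=
  fun t' ht' => h _ (.ctx f ts i t' ht')

theorem IsNF.of_subst {t : L.Term ℕ} {σ : ℕ → L.Term ℕ} (h : IsNF R (t.subst σ)) {x : ℕ}
    (hx : x ∈ t.varFinset) : IsNF R (σ x) := by
  induction t with
  | var y =>
    obtain rfl : x = y := by simpa using hx
    exact h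
  | func f ts ih =>
    obtain ⟨i, hi⟩ : ∃ i, x ∈ (ts i).varFinset := by simpa using hx
    exact ih i (IsNF.arg h i) hi

theorem subst_congr {t : L.Term ℕ} {σ τ : ℕ → L.Term ℕ} (h : ∀ x ∈ t.varFinset, σ x = τ x) :
    t.subst σ = t.subst τ := by
  induction t with
  | var y => exact h y (by simp)
  | func f ts ih =>
    simp only [Term.subst]
    congr 1
    funext i
    exact ih i fun x hx => h x (by simpa using ⟨i, hx⟩)

theorem IsConstructorTRS.isNF_subst (hC : IsConstructorTRS D R) {t : L.Term ℕ}
    {σ : ℕ → L.Term ℕ} (hσ : ∀ x, IsNF R (σ x)) (ht : IsValue D t) : IsNF R (t.subst σ) := by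
  induction t with
  | var y => exact hσ y
  | func f ts ih =>
    intro t' h
    rcases h.inv with ⟨l, r, τ, hr, hs⟩ | ⟨_, _, _, i, t', hs, h⟩
    · cases l with
      | var y => exact R.lhs_ne_var _ hr y rfl
      | func g ls =>
        obtain ⟨rfl, hf, -⟩ := Term.func.inj hs
        cases hf
        exact ht.1 (hC _ hr).1
    · obtain ⟨rfl, hf, hts⟩ := Term.func.inj hs
      cases hts
      exact ih i (ht.2 i) _ h

/-! ### Bounded terms -/

/-- All innermost reductions from `t` have length at most `n`, and all terms that occur in
them have depth at most `E`. -/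
def Bounded (R : TRS L) (E : ℕ) : ℕ → L.Term ℕ → Prop
  | 0, t => depth t ≤ E ∧ ∀ t', ¬ IRew R t t'
  | n + 1, t => depth t ≤ E ∧ ∀ t', IRew R t t' → Bounded R E n t'

theorem Bounded.depth_le {E n : ℕ} {t : L.Term ℕ} (h : Bounded R E n t) : depth t ≤ E := by
  cases n <;> exact h.1

theorem Bounded.mono {E E' n n' : ℕ} {t : L.Term ℕ} (hE : E ≤ E') (hn : n ≤ n')
    (h : Bounded R E n t) : Bounded R E' n' t := by
  induction n' generalizing n t with
  | zero =>
    obtain rfl : n = 0 := by omega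
    exact ⟨h.1.trans hE, h.2⟩
  | succ n' ih =>
    refine ⟨h.depth_le.trans hE, fun t' ht' => ?_⟩
    cases n with
    | zero => exact absurd ht' (h.2 t')
    | succ n => exact ih (by omega) (h.2 t' ht')

theorem Bounded.exists_lt {E n : ℕ} {t t' : L.Term ℕ} (h : Bounded R E n t)
    (ht : IRew R t t') : ∃ m < n, Bounded R E m t' := by
  cases n with
  | zero => exact absurd ht (h.2 t')
  | succ n => exact ⟨n, by omega, h.2 t' ht⟩

theorem Bounded.of_steps {E n : ℕ} {t : L.Term ℕ} (hE : depth t ≤ E)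
    (h : ∀ t', IRew R t t' → ∃ m < n, Bounded R E m t') : Bounded R E n t := by
  cases n with
  | zero =>
    refine ⟨hE, fun t' ht' => ?_⟩
    obtain ⟨m, hm, -⟩ := h t' ht'
    omega
  | succ n =>
    refine ⟨hE, fun t' ht' => ?_⟩
    obtain ⟨m, hm, hb⟩ := h t' ht'
    exact hb.mono le_rfl (by omega)

theorem IsNF.bounded {t : L.Term ℕ} {E : ℕ} (h : IsNF R t) (hE : depth t ≤ E) :
    Bounded R E 0 t :=
  ⟨hE, fun t' ht' => h t' ht'.rew⟩

theorem Bounded.length_le {E n ℓ : ℕ} {t : L.Term ℕ} (h : Bounded R E n t)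
    (hr : HasReduction R t ℓ) : ℓ ≤ n := by
  obtain ⟨u, rfl, hu⟩ := hr
  induction ℓ generalizing n u with
  | zero => omega
  | succ ℓ ih =>
    obtain ⟨m, hm, hb⟩ := h.exists_lt (hu 0 (by omega))
    have := ih (fun i => u (i + 1)) (fun i hi => hu (i + 1) (by omega)) hb
    omega

theorem Bounded.dheight_le {E n : ℕ} {t : L.Term ℕ} (h : Bounded R E n t) :
    dheight R t ≤ (n : ℕ∞) :=
  iSup₂_le fun _ hℓ => Nat.cast_le.2 (h.length_le hℓ)

theorem depth_func_le {n : ℕ} {f : L.Functions n} {ts : Fin n → L.Term ℕ} {E : ℕ} (h : 1 ≤ E)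
    (hts : ∀ i, depth (ts i) + 1 ≤ E) : depth (Term.func f ts) ≤ E := by
  have : (Finset.univ.sup fun i => depth (ts i)) ≤ E - 1 :=
    Finset.sup_le fun i _ => by have := hts i; omega
  simp only [depth]
  omega

theorem depth_arg_lt {n : ℕ} (f : L.Functions n) (ts : Fin n → L.Term ℕ) (i : Fin n) :
    depth (ts i) < depth (Term.func f ts) := by
  have := Finset.le_sup (f := fun i => depth (ts i)) (Finset.mem_univ i)
  simp only [depth]
  omega

/-- An innermost reduction of `f(t₁, …, tₙ)` reduces the arguments independently, until they
are normal forms and a step at the root can follow. -/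
theorem Bounded.func {n : ℕ} {f : L.Functions n} {T E : Fin n → ℕ} {T' E' : ℕ}
    (hE' : 1 ≤ E') (hE : ∀ i, E i + 1 ≤ E')
    (hroot : ∀ vs : Fin n → L.Term ℕ, (∀ i, IsNF R (vs i)) → (∀ i, depth (vs i) ≤ E i) →
      Bounded R E' T' (.func f vs))
    {ts : Fin n → L.Term ℕ} (hts : ∀ i, Bounded R (E i) (T i) (ts i)) :
    Bounded R E' ((∑ i, T i) + T') (.func f ts) := by
  induction hN : ∑ i, T i using Nat.strong_induction_on generalizing T ts with
  | _ N ih =>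
  subst hN
  refine .of_steps (depth_func_le hE' fun i => ?_) fun t' ht' => ?_
  · have := (hts i).depth_le
    have := hE i
    omega
  rcases ht'.inv_func with ⟨_, _, _, _, hnf, _, _⟩ | ⟨i, s, hs, rfl⟩
  · obtain ⟨m, hm, hb⟩ := (hroot ts hnf fun i => (hts i).depth_le).exists_lt ht'
    exact ⟨m, by omega, hb⟩
  · obtain ⟨m, hm, hb⟩ := (hts i).exists_lt hs
    have hlt : ∑ j, Function.update T i m j < ∑ j, T j := by
      refine Finset.sum_lt_sum (fun j _ => ?_) ⟨i, Finset.mem_univ i, by simpa using hm⟩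
      rcases eq_or_ne j i with rfl | hj
      · simpa using hm.le
      · simp [hj]
    refine ⟨_, Nat.add_lt_add_right hlt T', ih _ hlt (fun j => ?_) rfl⟩
    rcases eq_or_ne j i with rfl | hj
    · simpa using hb
    · simpa [hj] using hts j

/-! ### The orders on values -/

theorem SafeEquiv.depth_subst {s t : L.Term ℕ} (h : SafeEquiv P S s t) (σ : ℕ → L.Term ℕ) :
    depth (s.subst σ) = depth (t.subst σ) := by
  induction h with
  | refl => rfl
  | perm f g ss ts π _ _ _ ih =>
    simp only [Term.subst, depth, ih]
    congr 1
    refine le_antisymm (Finset.sup_le fun i _ => ?_) (Finset.sup_le fun i _ => ?_)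
    · exact Finset.le_sup (f := fun i => depth ((ts i).subst σ)) (Finset.mem_univ (π i))
    · simpa using Finset.le_sup (f := fun i => depth ((ts (π i)).subst σ))
        (Finset.mem_univ (π.symm i))

theorem SafeEquiv.isValue (hP : P.Admissible D) {s t : L.Term ℕ} (h : SafeEquiv P S s t)
    (hs : IsValue D s) : IsValue D t := by
  induction h with
  | refl => exact hs
  | perm f g ss ts π hfg _ _ ih =>
    refine ⟨fun hg => hs.1 ((hP _ _ hfg).2 hg), fun i => ?_⟩
    have := ih (π.symm i) (hs.2 _)
    rwa [Equiv.apply_symm_apply] at this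

theorem AuxGt.of_isValue (hP : P.Admissible D) {s t : L.Term ℕ} (h : AuxGt P S s t)
    (hs : IsValue D s) :
    IsValue D t ∧ ∀ σ : ℕ → L.Term ℕ, depth (t.subst σ) < depth (s.subst σ) := by
  induction h with
  | st_gt f ss t i _ _ ih =>
    obtain ⟨h1, h2⟩ := ih (hs.2 i)
    exact ⟨h1, fun σ => (h2 σ).trans (depth_arg_lt f (fun i => (ss i).subst σ) i)⟩
  | st_eq f ss t i _ h =>
    refine ⟨h.isValue hP (hs.2 i), fun σ => ?_⟩
    rw [← h.depth_subst σ]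
    exact depth_arg_lt f (fun i => (ss i).subst σ) i
  | ia f ss g ts hf => exact absurd hf hs.1

/-- Below a value the polynomial path order is the proper subterm relation, up to safe
equivalence; so it decreases the depth of all instances. -/
theorem PopGt.of_isValue (hP : P.Admissible D) {s t : L.Term ℕ} (h : PopGt P S s t)
    (hs : IsValue D s) :
    IsValue D t ∧ ∀ σ : ℕ → L.Term ℕ, depth (t.subst σ) < depth (s.subst σ) := by
  induction h with
  | st_gt f ss t i _ ih =>
    obtain ⟨h1, h2⟩ := ih (hs.2 i)
    exact ⟨h1, fun σ => (h2 σ).trans (depth_arg_lt f (fun i => (ss i).subst σ) i)⟩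
  | st_eq f ss t i h =>
    refine ⟨h.isValue hP (hs.2 i), fun σ => ?_⟩
    rw [← h.depth_subst σ]
    exact depth_arg_lt f (fun i => (ss i).subst σ) i
  | ia f ss g ts hf => exact absurd hf hs.1
  | ep f ss g ts hf => exact absurd hf hs.1

theorem popGt_or_safeEquiv_of_isValue (hP : P.Admissible D) {s t : L.Term ℕ}
    (h : PopGt P S s t ∨ SafeEquiv P S s t) (hs : IsValue D s) :
    IsValue D t ∧ ∀ σ : ℕ → L.Term ℕ, depth (t.subst σ) ≤ depth (s.subst σ) := by
  rcases h with h | h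
  · exact (h.of_isValue hP hs).imp_right fun h σ => (h σ).le
  · exact ⟨h.isValue hP hs, fun σ => (h.depth_subst σ).ge⟩

/-! ### Normal and safe arguments -/

theorem SafeMapping.mem_normalArgs {n : ℕ} {f : L.Functions n} {ts : Fin n → L.Term ℕ}
    {t : L.Term ℕ} : t ∈ S.normalArgs f ts ↔ ∃ i, ¬ S.IsSafe f i ∧ ts i = t := by
  simp [SafeMapping.normalArgs]

theorem SafeMapping.mem_safeArgs {n : ℕ} {f : L.Functions n} {ts : Fin n → L.Term ℕ}
    {t : L.Term ℕ} : t ∈ S.safeArgs f ts ↔ ∃ i, S.IsSafe f i ∧ ts i = t := by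
  simp [SafeMapping.safeArgs]

theorem SafeMapping.normalArgs_subst {n : ℕ} (f : L.Functions n) (ts : Fin n → L.Term ℕ)
    (σ : ℕ → L.Term ℕ) :
    S.normalArgs f (fun i => (ts i).subst σ) = (S.normalArgs f ts).map fun t => t.subst σ := by
  simp [SafeMapping.normalArgs, Multiset.map_map]

theorem SafeMapping.card_normalArgs_le {n : ℕ} (f : L.Functions n) (ts : Fin n → L.Term ℕ) :
    (S.normalArgs f ts).card ≤ n := by
  classical
  rw [SafeMapping.normalArgs, Multiset.card_map]
  exact (Finset.card_filter_le _ _).trans (by simp)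

/-- `ArgsBounded S f ts d e`: the normal arguments of `f(t₁, …, tₙ)` have depth at most `d`, the
safe ones have depth at most `e`. -/
def ArgsBounded (S : SafeMapping D) {n : ℕ} (f : L.Functions n) (ts : Fin n → L.Term ℕ)
    (d e : ℕ) : Prop :=
  (∀ i, ¬ S.IsSafe f i → depth (ts i) ≤ d) ∧ ∀ i, S.IsSafe f i → depth (ts i) ≤ e

/-- `A` is a bound for the symbol `f`: whenever the arguments are normal forms, `A` of the depth
of the normal ones bounds both the lengths of the innermost reductions and the excess in depth
over the safe ones. -/
def SymBounded (R : TRS L) (S : SafeMapping D) (A : ℕ → ℕ) (f : Sym L) : Prop :=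
  ∀ (vs : Fin f.1 → L.Term ℕ) (d e : ℕ), (∀ i, IsNF R (vs i)) → ArgsBounded S f.2 vs d e →
    Bounded R (A d + e) (A d) (.func f.2 vs)

/-- The growth of the bounds under one application of a symbol of arity at most `K` that is
bounded by `A`. -/
def growth (K : ℕ) (A : ℕ → ℕ) (b : ℕ) : ℕ := (K + 1) * b + A b + 1

theorem le_growth (K : ℕ) (A : ℕ → ℕ) (b : ℕ) : b ≤ growth K A b := by
  unfold growth
  nlinarith [Nat.zero_le (K * b)]

theorem growth_iterate_mono (K : ℕ) (A : ℕ → ℕ) {m n : ℕ} (h : m ≤ n) (b : ℕ) :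
    (growth K A)^[m] b ≤ (growth K A)^[n] b :=
  Function.monotone_iterate_of_id_le (le_growth K A) h b

theorem le_growth_iterate (K : ℕ) (A : ℕ → ℕ) (n b : ℕ) : b ≤ (growth K A)^[n] b :=
  growth_iterate_mono K A n.zero_le b

/-- Evaluation of `g(t₁, …, tₘ)`, where the normal arguments are bounded by `c`, and one safe
argument may have the extra cost `X`. -/
theorem SymBounded.bounded_func {A : ℕ → ℕ} {m K c e X : ℕ} {g : L.Functions m}
    {ts : Fin m → L.Term ℕ} {B : Set (Fin m)} (hA : SymBounded R S A ⟨m, g⟩) (hm : m ≤ K)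
    (hB : B.Subsingleton) (hnormal : ∀ j, ¬ S.IsSafe g j → Bounded R c c (ts j))
    (hsafe : ∀ j, S.IsSafe g j → j ∉ B → Bounded R (c + e) c (ts j))
    (hone : ∀ j, S.IsSafe g j → j ∈ B → Bounded R (c + e) (c + X) (ts j)) :
    Bounded R (growth K A c + e) (growth K A c + X) (.func g ts) := by
  classical
  have hsum : ∑ j, (c + if j ∈ B then X else 0) ≤ K * c + X := by
    rw [Finset.sum_add_distrib, Finset.sum_const, Finset.card_univ, Fintype.card_fin, smul_eq_mul,
      ← Finset.sum_filter, Finset.sum_const, smul_eq_mul]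
    have : (Finset.univ.filter fun j => j ∈ B).card ≤ 1 :=
      Finset.card_le_one.2 fun i hi j hj => hB (by simpa using hi) (by simpa using hj)
    nlinarith [Nat.mul_le_mul_right c hm, Nat.mul_le_mul_right X this]
  have hgrowth : growth K A c = K * c + c + A c + 1 := by
    unfold growth
    ring
  refine (Bounded.func (T := fun j => c + if j ∈ B then X else 0)
    (E := fun j => c + if S.IsSafe g j then e else 0) (T' := A c)
    (E' := growth K A c + e) (by omega) (fun j => ?_) (fun vs hvs hd => ?_)
    (fun j => ?_)).mono le_rfl (by omega)
  · split_ifs <;> omega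
  · refine (hA vs c (c + e) hvs ⟨fun j hj => ?_, fun j hj => ?_⟩).mono (by omega) le_rfl
    · simpa [hj] using hd j
    · simpa [hj] using hd j
  · by_cases hj : S.IsSafe g j
    · by_cases hjB : j ∈ B
      · simpa [hj, hjB] using hone j hj hjB
      · simpa [hj, hjB] using hsafe j hj hjB
    · simpa [hj] using (hnormal j hj).mono le_rfl (by omega)

/-! ### Evaluation of right-hand sides -/

section RightHandSides

variable {A : ℕ → ℕ} {K n d e : ℕ} {f : L.Functions n} {ls : Fin n → L.Term ℕ}
  {σ : ℕ → L.Term ℕ}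

theorem depth_arg_le_pred {m : ℕ} (g : L.Functions m) (ts : Fin m → L.Term ℕ) (j : Fin m) :
    depth (ts j) ≤ depth (Term.func g ts) - 1 := by
  have := depth_arg_lt g ts j
  omega

theorem growth_iterate_depth_func (K : ℕ) (A : ℕ → ℕ) {m : ℕ} (g : L.Functions m)
    (ts : Fin m → L.Term ℕ) (b : ℕ) :
    (growth K A)^[depth (Term.func g ts)] b =
      growth K A ((growth K A)^[depth (Term.func g ts) - 1] b) := by
  rw [← Function.iterate_succ_apply' (growth K A), Nat.succ_eq_add_one,
    Nat.sub_add_cancel (by simp [depth])]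

/-- A term below the left-hand side in the auxiliary order is built from normal arguments by
symbols below `f` only, so the safe arguments do not matter. -/
theorem AuxGt.bounded (hC : IsConstructorTRS D R) (hP : P.Admissible D)
    (hK : ∀ g : Sym L, g.1 ≤ K) (hA : ∀ g, P.gt ⟨n, f⟩ g → SymBounded R S A g)
    (hf : (⟨n, f⟩ : Sym L) ∈ D) (hls : ∀ i, IsValue D (ls i)) (hσ : ∀ x, IsNF R (σ x))
    (hd : ∀ i, ¬ S.IsSafe f i → depth ((ls i).subst σ) ≤ d) (t : L.Term ℕ)
    (h : AuxGt P S (.func f ls) t) :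
    Bounded R ((growth K A)^[depth t] d) ((growth K A)^[depth t] d) (t.subst σ) := by
  -- Terms reached through the subterm clauses are normal forms.
  have key : ∀ (t : L.Term ℕ) (i : Fin n), ¬ S.IsSafe f i →
      (IsValue D t ∧ depth (t.subst σ) ≤ depth ((ls i).subst σ)) →
      Bounded R ((growth K A)^[depth t] d) ((growth K A)^[depth t] d) (t.subst σ) :=
    fun t i hi ht => ((hC.isNF_subst hσ ht.1).bounded (ht.2.trans (hd i hi))).mono
      (le_growth_iterate ..) (Nat.zero_le _)
  induction t with
  | var x =>
    cases h with
    | st_gt _ _ _ i hi h =>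
      exact key _ i (hi hf) ((h.of_isValue hP (hls i)).imp_right fun h => (h σ).le)
    | st_eq _ _ _ i hi h =>
      exact key _ i (hi hf) ⟨h.isValue hP (hls i), (h.depth_subst σ).ge⟩
  | func g ts ih =>
    cases h with
    | st_gt _ _ _ i hi h =>
      exact key _ i (hi hf) ((h.of_isValue hP (hls i)).imp_right fun h => (h σ).le)
    | st_eq _ _ _ i hi h =>
      exact key _ i (hi hf) ⟨h.isValue hP (hls i), (h.depth_subst σ).ge⟩
    | ia _ _ _ _ _ hfg h =>
      rw [growth_iterate_depth_func]
      have hle := fun j => growth_iterate_mono K A (depth_arg_le_pred g ts j) d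
      have hts := fun j => (ih j (h j)).mono (hle j) (hle j)
      exact (hA _ hfg).bounded_func (e := 0) (X := 0) (hK ⟨_, g⟩) Set.subsingleton_empty
        (fun j _ => hts j) (fun j _ _ => hts j) (fun j _ _ => hts j)

/-- The bounds `Y + e`, `X` hold for all calls of symbols equivalent to `f` whose normal
arguments are smaller, and whose safe arguments are not deeper, than those of `f(v₁, …, vₙ)`. -/
def RecBounded (R : TRS L) (P : Precedence L) (S : SafeMapping D) {n : ℕ} (f : L.Functions n)
    (vs : Fin n → L.Term ℕ) (d e X Y : ℕ) : Prop :=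
  ∀ (m : ℕ) (g : L.Functions m) (ws : Fin m → L.Term ℕ), P.equiv ⟨n, f⟩ ⟨m, g⟩ →
    (∀ i, IsNF R (ws i)) → ArgsBounded S g ws d e →
    ((S.normalArgs g ws).map depth).IsDershowitzMannaLT ((S.normalArgs f vs).map depth) →
    Bounded R (Y + e) X (.func g ws)

/-- A term below the left-hand side contains at most one recursive call, in a position that is
reached through safe arguments only, so the cost of this call is added just once. -/
theorem PopGt.bounded (hC : IsConstructorTRS D R) (hP : P.Admissible D)
    (hK : ∀ g : Sym L, g.1 ≤ K) (hA : ∀ g, P.gt ⟨n, f⟩ g → SymBounded R S A g)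
    (hf : (⟨n, f⟩ : Sym L) ∈ D) (hls : ∀ i, IsValue D (ls i)) (hσ : ∀ x, IsNF R (σ x))
    (hde : ArgsBounded S f (fun i => (ls i).subst σ) d e) (t : L.Term ℕ)
    (h : PopGt P S (.func f ls) t) (X Y : ℕ)
    (hrec : ¬ OverSym (fun h => P.gt ⟨n, f⟩ h) t →
      RecBounded R P S f (fun i => (ls i).subst σ) d e X Y) :
    Bounded R ((growth K A)^[depth t] d + (Y + e)) ((growth K A)^[depth t] d + X)
      (t.subst σ) := by
  have key : ∀ (X Y : ℕ) (t : L.Term ℕ) (i : Fin n), PopGt P S (ls i) t ∨ SafeEquiv P S (ls i) t →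
      Bounded R ((growth K A)^[depth t] d + (Y + e)) ((growth K A)^[depth t] d + X)
        (t.subst σ) := by
    intro X Y t i ht
    obtain ⟨h1, h2⟩ := popGt_or_safeEquiv_of_isValue hP ht (hls i)
    refine ((hC.isNF_subst hσ h1).bounded ((h2 σ).trans ?_)).mono le_rfl (Nat.zero_le _)
    have := le_growth_iterate K A (depth t) d
    by_cases hi : S.IsSafe f i
    · exact (hde.2 i hi).trans (by omega)
    · exact (hde.1 i hi).trans (by omega)
  induction t generalizing X Y with
  | var x =>
    cases h with
    | st_gt _ _ _ i h => exact key X Y _ i (.inl h)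
    | st_eq _ _ _ i h => exact key X Y _ i (.inr h)
  | func g ts ih =>
    cases h with
    | st_gt _ _ _ i h => exact key X Y _ i (.inl h)
    | st_eq _ _ _ i h => exact key X Y _ i (.inr h)
    | ia _ _ _ _ _ hfg hnormal hsafe hone =>
      rw [growth_iterate_depth_func]
      have hle := fun j => growth_iterate_mono K A (depth_arg_le_pred g ts j) d
      refine (hA _ hfg).bounded_func (hK ⟨_, g⟩) hone (fun j hj => ?_) (fun j hj hjB => ?_)
        (fun j hj hjB => ?_)
      · exact (AuxGt.bounded hC hP hK hA hf hls hσ hde.1 _ (hnormal j hj)).mono (hle j) (hle j)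
      · -- Without a recursive call, the bounds `X = Y = 0` apply.
        have hover : OverSym (fun h => P.gt ⟨n, f⟩ h) (ts j) :=
          Classical.not_not.1 fun h => hjB ⟨hj, h⟩
        have := hle j
        exact (ih j (hsafe j hj) 0 0 (fun h => absurd hover h)).mono (by omega) (by omega)
      · have := hle j
        exact (ih j (hsafe j hj) X Y (fun _ => hrec fun h => hjB.2 (h.2 j))).mono
          (by omega) (by omega)
    | ep _ _ _ _ _ hfg Q hQ hnormal hsafe =>
      have hnormal := hnormal.mono hQ
      have hsafe := hsafe.mono hQ
      -- All arguments of the recursive call are safe-equivalent to subterms of arguments of the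
      -- left-hand side, so they are values, and only the root can be a redex.
      have hN : ∀ j, ¬ S.IsSafe g j → ∃ i, ¬ S.IsSafe f i ∧
          (PopGt P S (ls i) (ts j) ∨ SafeEquiv P S (ls i) (ts j)) := by
        intro j hj
        obtain ⟨a, ha, hab⟩ := hnormal.exists_mem (SafeMapping.mem_normalArgs.2 ⟨j, hj, rfl⟩)
        obtain ⟨i, hi, rfl⟩ := SafeMapping.mem_normalArgs.1 ha
        exact ⟨i, hi, hab⟩
      have hS : ∀ j, S.IsSafe g j → ∃ i, S.IsSafe f i ∧
          (PopGt P S (ls i) (ts j) ∨ SafeEquiv P S (ls i) (ts j)) := by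
        intro j hj
        obtain ⟨a, ha, hab⟩ := hsafe.exists_mem (SafeMapping.mem_safeArgs.2 ⟨j, hj, rfl⟩)
        obtain ⟨i, hi, rfl⟩ := SafeMapping.mem_safeArgs.1 ha
        exact ⟨i, hi, hab⟩
      refine (hrec (fun h => h.1.2 hfg.2) _ g (fun j => (ts j).subst σ) hfg (fun j => ?_)
        ⟨fun j hj => ?_, fun j hj => ?_⟩ ?_).mono (by omega) (by omega)
      · obtain ⟨i, h⟩ : ∃ i, PopGt P S (ls i) (ts j) ∨ SafeEquiv P S (ls i) (ts j) := by
          by_cases hj : S.IsSafe g j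
          · exact (hS j hj).imp fun _ h => h.2
          · exact (hN j hj).imp fun _ h => h.2
        exact hC.isNF_subst hσ (popGt_or_safeEquiv_of_isValue hP h (hls i)).1
      · obtain ⟨i, hi, h⟩ := hN j hj
        exact ((popGt_or_safeEquiv_of_isValue hP h (hls i)).2 σ).trans (hde.1 i hi)
      · obtain ⟨i, hi, h⟩ := hS j hj
        exact ((popGt_or_safeEquiv_of_isValue hP h (hls i)).2 σ).trans (hde.2 i hi)
      · rw [SafeMapping.normalArgs_subst, SafeMapping.normalArgs_subst, Multiset.map_map,
          Multiset.map_map]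
        refine hnormal.isDershowitzMannaLT _ (fun a b h => h.depth_subst σ) fun a ha b h => ?_
        obtain ⟨i, -, rfl⟩ := SafeMapping.mem_normalArgs.1 ha
        exact (h.of_isValue hP (hls i)).2 σ

end RightHandSides

/-! ### Induction along the precedence -/

/-- The number of symbols strictly below `f` in the precedence. -/
noncomputable def Precedence.level (P : Precedence L) (f : Sym L) : ℕ :=
  {g | P.gt f g}.ncard

theorem Precedence.level_lt [Finite (Sym L)] {f g : Sym L} (h : P.gt f g) :
    P.level g < P.level f := by
  refine Set.ncard_lt_ncard (Set.ssubset_iff_exists.2 ⟨fun k hk => ?_, g, h, fun hg => ?_⟩)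
  · exact ⟨P.trans _ _ _ h.1 hk.1, fun hkf => hk.2 (P.trans _ _ _ hkf h.1)⟩
  · exact hg.2 hg.1

theorem Precedence.level_eq {f g : Sym L} (h : P.equiv f g) : P.level f = P.level g := by
  unfold Precedence.level Precedence.gt
  congr 1
  ext k
  exact ⟨fun hk => ⟨P.trans _ _ _ h.2 hk.1, fun hkg => hk.2 (P.trans _ _ _ hkg h.2)⟩,
    fun hk => ⟨P.trans _ _ _ h.1 hk.1, fun hkf => hk.2 (P.trans _ _ _ hkf h.1)⟩⟩

/-- The bound for a call whose normal arguments have rank `r`: every recursive call decreases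
the rank, and what surrounds the recursive call costs at most `C`. -/
theorem bounded_of_rank_le [Finite (Sym L)] (hC : IsConstructorTRS D R) (hP : P.Admissible D)
    (hcomp : Compatible R P S) {K M : ℕ} (hK : ∀ g : Sym L, g.1 ≤ K)
    (hM : ∀ ρ ∈ R.rules, depth ρ.2 ≤ M) {A : ℕ → ℕ} {k : ℕ}
    (hA : ∀ g, P.level g < k → SymBounded R S A g) (d e r : ℕ) {n : ℕ} (f : L.Functions n)
    (hf : P.level ⟨n, f⟩ ≤ k) (vs : Fin n → L.Term ℕ) (hvs : ∀ i, IsNF R (vs i))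
    (hde : ArgsBounded S f vs d e)
    (hr : multisetRank d K ((S.normalArgs f vs).map depth) ≤ r) :
    Bounded R ((r + 1) * (1 + (growth K A)^[M] d) + d + e) ((r + 1) * (1 + (growth K A)^[M] d))
      (.func f vs) := by
  induction r using Nat.strong_induction_on generalizing n f vs with
  | _ r ih =>
  obtain ⟨C, hCdef⟩ : ∃ C, C = 1 + (growth K A)^[M] d := ⟨_, rfl⟩
  rw [← hCdef] at ih ⊢
  have hmul : (r + 1) * C = r * C + C := by ring
  refine .of_steps (depth_func_le (by omega) fun i => ?_) fun t' ht' => ?_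
  · by_cases hi : S.IsSafe f i
    · have := hde.2 i hi
      omega
    · have := hde.1 i hi
      omega
  rcases ht'.inv_func with ⟨ls, rhs, σ, hrule, -, rfl, rfl⟩ | ⟨i, s, hs, -⟩
  · -- The variables of `rhs` occur in the left-hand side, so the values of `σ` elsewhere
    -- may be replaced by variables.
    let τ : ℕ → L.Term ℕ := fun x =>
      if x ∈ (Term.func f ls).varFinset then σ x else .var x
    have hls : ∀ i, (ls i).subst σ = (ls i).subst τ := fun i => subst_congr fun x hx => by
      have : x ∈ (Term.func f ls).varFinset := by simpa using ⟨i, hx⟩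
      simp only [τ, if_pos this]
    have hrhs : rhs.subst σ = rhs.subst τ := subst_congr fun x hx => by
      simp only [τ, if_pos (R.vars_subset _ hrule hx)]
    have hτ : ∀ x, IsNF R (τ x) := by
      intro x
      by_cases hx : x ∈ (Term.func f ls).varFinset
      · obtain ⟨i, hi⟩ : ∃ i, x ∈ (ls i).varFinset := by simpa using hx
        simpa only [τ, if_pos hx] using IsNF.of_subst (hvs i) hi
      · simpa only [τ, if_neg hx] using isNF_var x
    simp only [hls] at hde hr
    rw [hrhs]
    have hbasic := hC _ hrule
    have := PopGt.bounded (K := K) (A := A) (d := d) (e := e) hC hP hK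
      (fun g hg => hA g ((P.level_lt hg).trans_le hf)) hbasic.1 hbasic.2 hτ hde rhs
      (hcomp _ hrule) (r * C) (r * C + d) fun _ m g ws hfg hws hde' hlt => by
        have hlt' := (multisetRank_lt (d := d) (k := K) (by
          rw [Multiset.card_map]
          exact (S.card_normalArgs_le g ws).trans (hK ⟨m, g⟩)) (by
          intro a ha
          obtain ⟨t, ht, rfl⟩ := Multiset.mem_map.1 ha
          obtain ⟨i, hi, rfl⟩ := SafeMapping.mem_normalArgs.1 ht
          exact hde'.1 i hi) hlt).trans_le hr
        obtain ⟨r, rfl⟩ : ∃ r', r = r' + 1 := ⟨r - 1, by omega⟩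
        exact ih r (by omega) g (by rw [← P.level_eq hfg]; exact hf) ws hws hde' (by omega)
    have hle : (growth K A)^[depth rhs] d ≤ (growth K A)^[M] d :=
      growth_iterate_mono K A (hM _ hrule) d
    exact ⟨r * C + (growth K A)^[M] d, by omega, this.mono (by omega) (by omega)⟩
  · exact absurd hs.rew (hvs i s)

/-- Every symbol has a polynomial bound, by induction on its level. The degree grows with each
level, as the bound of a level is iterated as often as the right-hand sides are deep. -/
theorem exists_symBounded [Finite (Sym L)] (hC : IsConstructorTRS D R) (hP : P.Admissible D)
    (hcomp : Compatible R P S) (k : ℕ) :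
    ∃ A : Polynomial ℕ, ∀ g, P.level g < k → SymBounded R S (fun d => A.eval d) g := by
  obtain ⟨K, hK⟩ : ∃ K, ∀ g : Sym L, g.1 ≤ K := by
    obtain ⟨K, hK⟩ := (Set.finite_range fun g : Sym L => g.1).bddAbove
    exact ⟨K, fun g => hK ⟨g, rfl⟩⟩
  obtain ⟨M, hM⟩ : ∃ M, ∀ ρ ∈ R.rules, depth ρ.2 ≤ M := by
    obtain ⟨M, hM⟩ := (R.finite.image fun ρ => depth ρ.2).bddAbove
    exact ⟨M, fun ρ hρ => hM ⟨ρ, hρ, rfl⟩⟩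
  induction k with
  | zero => exact ⟨0, fun g hg => absurd hg (Nat.not_lt_zero _)⟩
  | succ k ih =>
    obtain ⟨A, hA⟩ := ih
    let G : Polynomial ℕ := (Polynomial.C (K + 1) * Polynomial.X + A + 1)
    have hG : ∀ d, (G.comp^[M] Polynomial.X).eval d =
        (growth K fun d => A.eval d)^[M] d := by
      intro d
      rw [Polynomial.iterate_comp_eval, Polynomial.eval_X]
      congr 1
      funext b
      simp [G, growth]
    refine ⟨((Polynomial.X + 2) ^ K + 1) * (1 + G.comp^[M] Polynomial.X) + Polynomial.X,
      fun ⟨n, f⟩ hf vs d e hvs hde => ?_⟩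
    have := bounded_of_rank_le hC hP hcomp hK hM hA d e _ f (Nat.lt_succ_iff.1 hf) vs hvs hde
      (multisetRank_le d K _)
    refine this.mono ?_ ?_ <;> simp [hG]

/-! ### Uniformity in the precedence and the safe mapping -/

instance [Finite (Sym L)] : Finite (Precedence L) :=
  Finite.of_injective (fun P : Precedence L => P.ge) fun P Q h => by
    cases P; cases Q; cases h; rfl

instance [Finite (Sym L)] : Finite (SafeMapping D) :=
  Finite.of_injective (fun S : SafeMapping D => S.safe) fun S S' h => by
    cases S; cases S'; cases h; rfl

theorem eval_le_eval_of_le (p : Polynomial ℕ) {a b : ℕ} (h : a ≤ b) : p.eval a ≤ p.eval b := by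
  rw [Polynomial.eval_eq_sum_range, Polynomial.eval_eq_sum_range]
  gcongr

theorem depth_le_size (t : L.Term ℕ) : depth t ≤ size t := by
  induction t with
  | var x => simp [depth, size]
  | func f ts ih =>
    simp only [depth, size]
    gcongr
    exact Finset.sup_le fun i hi =>
      (ih i).trans (Finset.single_le_sum (f := fun i => size (ts i)) (fun _ _ => Nat.zero_le _) hi)

theorem SafeMapping.normalDepth_le_size (S : SafeMapping D) {n : ℕ} (f : L.Functions n)
    (us : Fin n → L.Term ℕ) : S.normalDepth f us ≤ size (Term.func f us) := by
  refine Finset.sup_le fun i _ => ((depth_arg_lt f us i).le.trans (depth_le_size _))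

theorem dheight_func_le (hC : IsConstructorTRS D R) {A : ℕ → ℕ} {n : ℕ} {f : L.Functions n}
    (hA : SymBounded R S A ⟨n, f⟩) {us : Fin n → L.Term ℕ} (hus : ∀ i, IsValue D (us i)) :
    dheight R (Term.func f us) ≤ ((A (S.normalDepth f us) : ℕ) : ℕ∞) := by
  have hsub : ∀ t : L.Term ℕ, t.subst Term.var = t := fun t => by
    induction t with
    | var x => rfl
    | func f ts ih => simp only [Term.subst, ih]
  refine (hA us _ (Finset.univ.sup fun i => depth (us i)) (fun i => ?_)
    ⟨fun i hi => ?_, fun i _ => ?_⟩).dheight_le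
  · simpa only [hsub] using hC.isNF_subst (σ := Term.var) isNF_var (hus i)
  · exact Finset.le_sup (f := fun i => depth (us i)) (by simpa using hi)
  · exact Finset.le_sup (f := fun i => depth (us i)) (Finset.mem_univ i)

theorem dheight_var (x : ℕ) : dheight R (Term.var x) = 0 :=
  nonpos_iff_eq_zero.1 ((isNF_var x).bounded le_rfl).dheight_le

end PopStar

theorem theorem3p5 {L : FirstOrder.Language} [Finite (PopStar.Sym L)]
    (D : Set (PopStar.Sym L)) (R : PopStar.TRS L)
    (hR : PopStar.IsPredicativeRecursive D R) :
    (∃ p : Polynomial ℕ,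
      ∀ (P : PopStar.Precedence L) (S : PopStar.SafeMapping D),
        P.Admissible D → PopStar.Compatible R P S →
        ∀ (n : ℕ) (f : L.Functions n) (us : Fin n → L.Term ℕ),
          (⟨n, f⟩ : PopStar.Sym L) ∈ D → (∀ i, PopStar.IsValue D (us i)) →
          PopStar.dheight R (FirstOrder.Language.Term.func f us) ≤
            ((p.eval (S.normalDepth f us) : ℕ) : ℕ∞)) ∧
    (∃ q : Polynomial ℕ, ∀ n : ℕ, PopStar.rc D R n ≤ ((q.eval n : ℕ) : ℕ∞)) := by
  obtain ⟨hC, P₀, S₀, hP₀, hcomp₀⟩ := hR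
  have hex : ∀ x : PopStar.Precedence L × PopStar.SafeMapping D, ∃ p : Polynomial ℕ,
      x.1.Admissible D → PopStar.Compatible R x.1 x.2 →
        ∀ g, PopStar.SymBounded R x.2 (fun d => p.eval d) g := by
    rintro ⟨P, S⟩
    by_cases h : P.Admissible D ∧ PopStar.Compatible R P S
    · obtain ⟨p, hp⟩ := PopStar.exists_symBounded hC h.1 h.2
        ((Set.univ : Set (PopStar.Sym L)).ncard + 1)
      exact ⟨p, fun _ _ g => hp g (Nat.lt_succ_of_le (Set.ncard_le_ncard (Set.subset_univ _)))⟩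
    · exact ⟨0, fun h₁ h₂ => absurd ⟨h₁, h₂⟩ h⟩
  choose p hp using hex
  have hbound : ∃ p : Polynomial ℕ,
      ∀ (P : PopStar.Precedence L) (S : PopStar.SafeMapping D),
        P.Admissible D → PopStar.Compatible R P S →
        ∀ (n : ℕ) (f : L.Functions n) (us : Fin n → L.Term ℕ),
          (⟨n, f⟩ : PopStar.Sym L) ∈ D → (∀ i, PopStar.IsValue D (us i)) →
          PopStar.dheight R (FirstOrder.Language.Term.func f us) ≤
            ((p.eval (S.normalDepth f us) : ℕ) : ℕ∞) := by
    have := Fintype.ofFinite (PopStar.Precedence L × PopStar.SafeMapping D)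
    refine ⟨∑ x, p x, fun P S hP hcomp n f us _ hus => ?_⟩
    refine (PopStar.dheight_func_le hC (hp (P, S) hP hcomp ⟨n, f⟩) hus).trans
      (Nat.cast_le.2 ?_)
    rw [Polynomial.eval_finsetSum]
    exact Finset.single_le_sum (f := fun x => (p x).eval (S.normalDepth f us))
      (fun _ _ => Nat.zero_le _) (Finset.mem_univ (P, S))
  refine ⟨hbound, ?_⟩
  obtain ⟨q, hq⟩ := hbound
  refine ⟨q, fun n => iSup_le fun s => iSup_le fun hs => iSup_le fun hn => ?_⟩
  cases s with
  | var x => simp [PopStar.dheight_var]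
  | func f us =>
    exact (hq P₀ S₀ hP₀ hcomp₀ _ f us hs.1 hs.2).trans (Nat.cast_le.2
      (PopStar.eval_le_eval_of_le q ((S₀.normalDepth_le_size f us).trans hn)))
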